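/- Throughout, all groups are finite. A set $\mathcal M$ of maximal subgroups of a group $G$ is irredundant if its intersection is not equal to the intersection of any proper subset of $\mathcal M$ (the empty intersection being $G$). Let $\mathrm{Mindim}(G)$ be the minimal size of an irredundant set of maximal subgroups of $G$ that is not properly contained in any other irredundant set of maximal subgroups, and let $\alpha(G)$ be the minimal size of a set of maximal subgroups of $G$ whose intersection is the Frattini subgroup of $G$. Let $D_8=\langle a,b\mid a^4,b^2,abab\rangle$ be the dihedral group of order $8$, and let $X$ be the subgroup of $D_8\times D_8\times D_8$ generated by $x_1=(a,b,b)$ and $x_2=(b,ab,a)$. Put $y_1=x_1^2$, $y_2=x_2^2$, $y_3=[x_1,x_2]$, and let $$N_1=\langle y_1,y_2\rangle,\qquad N_2=\langle y_1,y_1y_2y_3\rangle,\qquad N_3=\langle y_2,y_1y_2y_3\rangle .$$ (1) $|X|=32$, and $X$ is isomorphic to the quotient of the free group $F$ of rank $2$ by the intersection of all normal subgroups $K$ of $F$ with $F/K\cong D_8$. Each $N_i$ is a normal subgroup of $X$ with $X/N_i\cong D_8$. (2) There exist irreducible $2$-dimensional $\mathbb F_3X$-modules $A_1,A_2,A_3$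 such that $C_X(A_i)=N_i$ for $i=1,2,3$. (3) For any such $A_1,A_2,A_3$, let $G=(A_1\times A_2\times A_3){:}X$ be the semidirect product with respect to the componentwise action. Then $G$ is a finite soluble group with $\alpha(G)\geqslant 6$ and $\mathrm{Mindim}(G)\leqslant 5$. For every positive integer $k$, the direct power $\Gamma_k=G^k$ is soluble, and $\alpha(\Gamma_k)\geqslant 6k$ and $\mathrm{Mindim}(\Gamma_k)\leqslant 5k$, so $\alpha(\Gamma_k)-\mathrm{Mindim}(\Gamma_k)\geqslant k$. (4) Consequently, for every $n$ there is a finite soluble group $H$ with $\alpha(H)-\mathrm{Mindim}(H)\geqslant n$. -/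

import Mathlib

noncomputable section

namespace SolubleExample

/-! ### Irredundant sets of maximal subgroups -/

/-- A set `M` of maximal subgroups of `G` whose intersection differs from the intersection of
every proper subset of `M` (the empty intersection is `G`). -/
def IsIrredundant {G : Type*} [Group G] (M : Set (Subgroup G)) : Prop :=
  (∀ H ∈ M, IsCoatom H) ∧ ∀ T : Set (Subgroup G), T ⊂ M → sInf T ≠ sInf M

/-- An irredundant set of maximal subgroups that is not properly contained in any other
irredundant set of maximal subgroups. -/
def IsMaximalIrredundant {G : Type*} [Group G] (M : Set (Subgroup G)) : Prop :=
  Maximal IsIrredundant M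

/-- The minimal dimension of a finite group: the minimal size of a maximal irredundant set of
maximal subgroups. -/
def Mindim (G : Type*) [Group G] : ℕ :=
  sInf {n | ∃ M : Set (Subgroup G), IsMaximalIrredundant M ∧ M.ncard = n}

/-- The invariant `α(G)` of a finite group: the minimal size of a set of maximal subgroups of `G`
whose intersection is the Frattini subgroup. -/
def alpha (G : Type*) [Group G] : ℕ :=
  sInf {n | ∃ T : Set (Subgroup G), (∀ H ∈ T, IsCoatom H) ∧ sInf T = frattini G ∧ T.ncard = n}

/-- For a finite group the minimum that defines `Mindim` is over a nonempty set. -/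
theorem exists_ncard_eq_Mindim (G : Type*) [Group G] [Finite G] :
    ∃ M : Set (Subgroup G), IsMaximalIrredundant M ∧ M.ncard = Mindim G := by
  have hne : {n | ∃ M : Set (Subgroup G), IsMaximalIrredundant M ∧ M.ncard = n}.Nonempty := by
    have h0 : IsIrredundant (∅ : Set (Subgroup G)) :=
      ⟨fun H hH => absurd hH (Set.notMem_empty H),
        fun T hT => absurd (Set.empty_subset T) hT.2⟩
    obtain ⟨M, -, hM⟩ := Finite.exists_le_maximal h0
    exact ⟨M.ncard, M, hM, rfl⟩
  exact Nat.sInf_mem hne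

/-- For a finite group the minimum that defines `alpha` is over a nonempty set. -/
theorem exists_ncard_eq_alpha (G : Type*) [Group G] :
    ∃ T : Set (Subgroup G), (∀ H ∈ T, IsCoatom H) ∧ sInf T = frattini G ∧
      T.ncard = alpha G := by
  have hne : {n | ∃ T : Set (Subgroup G), (∀ H ∈ T, IsCoatom H) ∧ sInf T = frattini G ∧
      T.ncard = n}.Nonempty :=
    ⟨_, {H | IsCoatom H}, fun _ h => h, by rw [frattini, Order.radical, sInf_eq_iInf], rfl⟩
  exact Nat.sInf_mem hne

/-! ### The group `X` of order 32 -/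

/-- The dihedral group of order 8. -/
abbrev D8 : Type := DihedralGroup 4

/-- The rotation of order 4 in `D8`. -/
def a : D8 := DihedralGroup.r 1

/-- A reflection in `D8`. -/
def b : D8 := DihedralGroup.sr 0

/-- The subgroup of `D8 × D8 × D8` generated by `(a, b, b)` and `(b, ab, a)`. -/
def X : Subgroup (D8 × D8 × D8) :=
  Subgroup.closure {(a, b, b), (b, a * b, a)}

/-- The first generator `(a, b, b)` of `X`. -/
def x₁ : X := ⟨(a, b, b), Subgroup.subset_closure (by simp)⟩

/-- The second generator `(b, ab, a)` of `X`. -/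
def x₂ : X := ⟨(b, a * b, a), Subgroup.subset_closure (by simp)⟩

/-- `y₁ = x₁² = (a², 1, 1)`. -/
def y₁ : X := x₁ ^ 2

/-- `y₂ = x₂² = (1, 1, a²)`. -/
def y₂ : X := x₂ ^ 2

/-- `y₃ = [x₁, x₂] = (a², a², a²)`. -/
def y₃ : X := x₁⁻¹ * x₂⁻¹ * x₁ * x₂

/-- The three normal subgroups `⟨y₁, y₂⟩`, `⟨y₁, y₁y₂y₃⟩`, `⟨y₂, y₁y₂y₃⟩` of `X`. -/
def N : Fin 3 → Subgroup X :=
  ![Subgroup.closure {y₁, y₂}, Subgroup.closure {y₁, y₁ * y₂ * y₃},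
    Subgroup.closure {y₂, y₁ * y₂ * y₃}]

/-- The intersection of all normal subgroups of the free group of rank 2 with quotient
isomorphic to `D8`. -/
def freeKernel : Subgroup (FreeGroup (Fin 2)) :=
  sInf {K | ∃ _ : K.Normal, Nonempty (FreeGroup (Fin 2) ⧸ K ≃* D8)}

instance freeKernel_normal : freeKernel.Normal := by
  constructor
  intro n hn g
  rw [freeKernel, Subgroup.mem_sInf] at hn ⊢
  rintro K ⟨hK, e⟩
  exact hK.conj_mem n (hn K ⟨hK, e⟩) g

/-! ### The semidirect product `(A₁ × A₂ × A₃) : X` -/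

/-- The componentwise action by automorphisms of `X` on the direct product of the additive groups
of three `X`-modules, written multiplicatively. -/
def action {A : Fin 3 → Type*} [∀ i, AddCommGroup (A i)] [∀ i, Module (ZMod 3) (A i)]
    (ρ : ∀ i, Representation (ZMod 3) X (A i)) :
    X →* MulAut (Multiplicative (∀ i, A i)) where
  toFun x := AddEquiv.toMultiplicative
    { toFun := fun v i => ρ i x (v i)
      invFun := fun v i => ρ i x⁻¹ (v i)
      left_inv := fun v => by funext i; simp
      right_inv := fun v => by funext i; simp
      map_add' := fun v w => by funext i; simp }
  map_one' := by
    refine MulEquiv.ext fun v => ?_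
    apply Multiplicative.toAdd.injective
    funext i
    change ρ i 1 (v.toAdd i) = v.toAdd i
    simp
  map_mul' x y := by
    refine MulEquiv.ext fun v => ?_
    apply Multiplicative.toAdd.injective
    funext i
    change ρ i (x * y) (v.toAdd i) = ρ i x (ρ i y (v.toAdd i))
    simp

/-- The semidirect product `(A₁ × A₂ × A₃) : X`. -/
abbrev SemiProd {A : Fin 3 → Type*} [∀ i, AddCommGroup (A i)] [∀ i, Module (ZMod 3) (A i)]
    (ρ : ∀ i, Representation (ZMod 3) X (A i)) : Type _ :=
  Multiplicative (∀ i, A i) ⋊[action ρ] X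

/-- The data of the three modules: every `A i` is an irreducible 2-dimensional `X`-module over
the field with three elements, and `C_X(A i) = N i`. -/
def IsModuleTriple {A : Fin 3 → Type*} [∀ i, AddCommGroup (A i)] [∀ i, Module (ZMod 3) (A i)]
    (ρ : ∀ i, Representation (ZMod 3) X (A i)) : Prop :=
  ∀ i, (ρ i).IsIrreducible ∧ Module.finrank (ZMod 3) (A i) = 2 ∧ MonoidHom.ker (ρ i) = N i

end SolubleExample

end

noncomputable section

namespace SolubleExample

/-! ### The group `X` -/

/-! Everything rests on three central involutions $z_1,z_2,z_3$ of $X$, namely `centralInvolution`.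
Each $z_i$ inverts $A_i$, centralizes the other two modules, and is a square in $X$. Together they
generate the common kernel $\Phi$ of the two parities, and $X/\Phi$ is a Klein four-group. In a
direct power of $G$, conjugation by the copy of $z_i$ in factor $c$ changes an element only by its
own $(c,i)$-coordinate (`embX_centralInvolution_mul`).

Let $K$ be a maximal subgroup of the power. Commutators with $z_i$ show that $K$ fails to contain at
most one of the modules (`misses_unique`). If $K$ contains the module $(c,i)$, then it also contains
$z_i$: otherwise $K$ would be normal with $z_i$ generating the quotient of order two, where the
square $z_i$ must vanish (`embX_mem_of_not_misses`).

Lower bound: the Frattini subgroup is trivial. If a family of maximal subgroups has at most one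
member missing $(c,i)$, some $z_iu$ with $u\in A_i$ lies in all of them, and $z_iu\ne1$. So each of
the $3k$ modules needs two members of its own (`exists_two_misses`, `le_alpha`).

Upper bound: in each factor take the three complements fixing the zero vector of one module, and the
two parity kernels. These $5k$ subgroups are irredundant. If a further maximal subgroup $K$ could be
added, it would miss some $(c,i)$, since otherwise it contains the intersection $\Phi^k$. It then
contains $z_iu$ with $u\neq0$, since $u=0$ makes $K$ one of the chosen complements. Irredundance of
the enlarged set yields elements of $X$ that fix $u$ and generate $X$ modulo $\Phi$; as $\Phi$
preserves $\{u,-u\}$, so does $X$, against irreducibility in dimension two (`parity_stabilizer`). -/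

/-- The parity of the rotation index of an element of `D8`. -/
def rotParity : D8 →* Multiplicative (ZMod 2) where
  toFun g := match g with
    | .r i => .ofAdd (ZMod.castHom (by decide : 2 ∣ 4) (ZMod 2) i)
    | .sr i => .ofAdd (ZMod.castHom (by decide : 2 ∣ 4) (ZMod 2) i)
  map_one' := by decide
  map_mul' := by decide +kernel

/-- The homomorphism from `D8` to a group of order two whose kernel is the rotation subgroup. -/
def reflParity : D8 →* Multiplicative (ZMod 2) where
  toFun g := match g with
    | .r _ => .ofAdd 0
    | .sr _ => .ofAdd 1
  map_one' := by decide
  map_mul' := by decide +kernel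

theorem exists_word (p q r : D8) (h1 : rotParity q = reflParity p)
    (h2 : reflParity q = rotParity p * reflParity p) (h3 : rotParity r = reflParity p)
    (h4 : reflParity r = rotParity p) :
    ∃ i j k l m : Fin 2, (p, q, r) = (a, b, b) ^ i.val * (b, a * b, a) ^ j.val *
      ((a ^ 2, 1, 1) ^ k.val * (1, a ^ 2, 1) ^ l.val * (1, 1, a ^ 2) ^ m.val) := by
  revert p q r
  decide +kernel

/-- The group is the preimage of a Klein four-group in the cube of $D_8/\langle a^2\rangle$: the
first coordinate modulo $a^2$ determines the other two. This makes membership decidable, so that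
facts about all of `X` can be checked by enumeration. -/
theorem mem_X_iff {g : D8 × D8 × D8} : g ∈ X ↔ rotParity g.2.1 = reflParity g.1 ∧
    reflParity g.2.1 = rotParity g.1 * reflParity g.1 ∧ rotParity g.2.2 = reflParity g.1 ∧
    reflParity g.2.2 = rotParity g.1 := by
  constructor
  · intro hg
    induction hg using Subgroup.closure_induction with
    | mem x hx => rcases hx with rfl | rfl <;> decide
    | one => decide
    | mul x y _ _ hx hy =>
      obtain ⟨h1, h2, h3, h4⟩ := hx
      obtain ⟨h5, h6, h7, h8⟩ := hy
      refine ⟨?_, ?_, ?_, ?_⟩ <;> simp only [Prod.fst_mul, Prod.snd_mul, map_mul, *]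
      exact mul_mul_mul_comm _ _ _ _
    | inv x _ hx =>
      obtain ⟨h1, h2, h3, h4⟩ := hx
      refine ⟨?_, ?_, ?_, ?_⟩ <;> simp only [Prod.fst_inv, Prod.snd_inv, map_inv, *]
      exact mul_inv _ _
  · obtain ⟨p, q, r⟩ := g
    rintro ⟨h1, h2, h3, h4⟩
    obtain ⟨i, j, k, l, m, h⟩ := exists_word p q r h1 h2 h3 h4
    have e1 : (a, b, b) ∈ X := x₁.2
    have e2 : (b, a * b, a) ∈ X := x₂.2
    have f1 : ((a ^ 2, 1, 1) : D8 × D8 × D8) = (a, b, b) ^ 2 := by decide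
    have f2 : ((1, a ^ 2, 1) : D8 × D8 × D8) = ((a, b, b) * (b, a * b, a)) ^ 2 := by decide
    have f3 : ((1, 1, a ^ 2) : D8 × D8 × D8) = (b, a * b, a) ^ 2 := by decide
    rw [h, f1, f2, f3]
    have e3 := mul_mem e1 e2
    exact mul_mem (mul_mem (pow_mem e1 _) (pow_mem e2 _)) (mul_mem (mul_mem
      (pow_mem (pow_mem e1 _) _) (pow_mem (pow_mem e3 _) _)) (pow_mem (pow_mem e2 _) _))

instance : DecidablePred (· ∈ X) := fun _ => decidable_of_iff' _ mem_X_iff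

theorem card_X : Nat.card X = 32 := by
  have : Nat.card X = Fintype.card {g : D8 × D8 × D8 // g ∈ X} := Nat.card_eq_fintype_card
  rw [this]
  decide +kernel

theorem closure_generators : Subgroup.closure {x₁, x₂} = ⊤ := by
  have h := Subgroup.closure_closure_coe_preimage
    (k := ({(a, b, b), (b, a * b, a)} : Set (D8 × D8 × D8)))
  refine Eq.trans (congrArg _ ?_) h
  ext x
  exact or_congr Subtype.ext_iff Subtype.ext_iff

/-- The three coordinate projections of `X`, numbered so that the `i`-th has kernel `N i`. -/
def proj : Fin 3 → X →* D8 :=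
  ![((MonoidHom.fst D8 D8).comp (MonoidHom.snd D8 (D8 × D8))).comp X.subtype,
    ((MonoidHom.snd D8 D8).comp (MonoidHom.snd D8 (D8 × D8))).comp X.subtype,
    (MonoidHom.fst D8 (D8 × D8)).comp X.subtype]

theorem proj_surjective (i : Fin 3) : Function.Surjective (proj i) := by
  have : ∀ i, ∀ d : D8, ∃ x : {g : D8 × D8 × D8 // g ∈ X}, proj i x = d := by decide +kernel
  exact this i

theorem ker_proj (i : Fin 3) : (proj i).ker = N i := by
  have h1 : ∀ i, ∀ x : {g : D8 × D8 × D8 // g ∈ X}, proj i x = 1 →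
      ∃ k l : Fin 2, x = (![y₁, y₁, y₂] i) ^ k.val *
        (![y₂, y₁ * y₂ * y₃, y₁ * y₂ * y₃] i) ^ l.val := by decide +kernel
  have hN : N i = Subgroup.closure {![y₁, y₁, y₂] i, ![y₂, y₁ * y₂ * y₃, y₁ * y₂ * y₃] i} := by
    fin_cases i <;> rfl
  rw [hN]
  apply le_antisymm
  · intro x hx
    obtain ⟨k, l, h⟩ := h1 i x hx
    rw [h]
    exact mul_mem (pow_mem (Subgroup.subset_closure (by simp)) _)
      (pow_mem (Subgroup.subset_closure (by simp)) _)
  · rw [Subgroup.closure_le]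
    have h2 : ∀ i, proj i (![y₁, y₁, y₂] i) = 1 ∧
        proj i (![y₂, y₁ * y₂ * y₃, y₁ * y₂ * y₃] i) = 1 := by decide +kernel
    rintro x (rfl | rfl)
    exacts [(h2 i).1, (h2 i).2]

theorem nonempty_quotient_N (i : Fin 3) :
    ∃ _ : (N i).Normal, Nonempty (X ⧸ N i ≃* D8) := by
  rw [← ker_proj]
  exact ⟨inferInstance, ⟨QuotientGroup.quotientKerEquivOfSurjective _ (proj_surjective i)⟩⟩

/-- The surjection from the free group that sends the generators to `x₁` and `x₂`. -/
def freeMap : FreeGroup (Fin 2) →* X := FreeGroup.lift ![x₁, x₂]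

theorem freeMap_surjective : Function.Surjective freeMap := by
  rw [← MonoidHom.range_eq_top, freeMap, FreeGroup.range_lift_eq_closure, ← closure_generators]
  congr 1
  simp [Matrix.range_cons, Set.pair_comm]

/-- The automorphism `a ↦ a ^ e`, `b ↦ b a ^ c` of `D8`, for a unit `e`. -/
def dihedralHom (e : (ZMod 4)ˣ) (c : ZMod 4) : D8 →* D8 where
  toFun g := match g with
    | .r i => .r (e * i)
    | .sr i => .sr (e * i + c)
  map_one' := congrArg DihedralGroup.r (mul_zero _)
  map_mul' := by rintro (i | i) (j | j) <;> simp <;> ring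

/-- A pair either lies in one of the three maximal subgroups of $D_8$ or generates. The 24
generating pairs form three orbits under the 8 automorphisms, according to which of $u$, $v$, $uv$
has order 4; the three projections of $(x_1,x_2)$ represent these orbits. -/
theorem exists_dihedralHom (u v : D8) :
    (∃ χ : Fin 3, ![rotParity, reflParity, rotParity * reflParity] χ u = 1 ∧
      ![rotParity, reflParity, rotParity * reflParity] χ v = 1) ∨
    ∃ e c i, dihedralHom e c (proj i x₁) = u ∧ dihedralHom e c (proj i x₂) = v := by
  revert u v
  decide +kernel

theorem ker_freeMap : freeMap.ker = freeKernel := by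
  apply le_antisymm
  · intro w hw
    rw [freeKernel, Subgroup.mem_sInf]
    rintro K ⟨hK, ⟨f⟩⟩
    set φ : FreeGroup (Fin 2) →* D8 := f.toMonoidHom.comp (QuotientGroup.mk' K) with hφ
    have hs : Function.Surjective φ :=
      f.surjective.comp (QuotientGroup.mk'_surjective K)
    have hk : φ w = 1 → w ∈ K := fun h => by
      simpa [hφ] using h
    apply hk
    rcases exists_dihedralHom (φ (.of 0)) (φ (.of 1)) with ⟨χ, h0, h1⟩ | ⟨e, c, i, h0, h1⟩
    · exfalso
      have : (![rotParity, reflParity, rotParity * reflParity] χ).comp φ = 1 := by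
        ext j
        fin_cases j
        · simpa using! h0
        · simpa using! h1
      have h2 : ∀ χ : Fin 3, ∃ d, ![rotParity, reflParity, rotParity * reflParity] χ d ≠ 1 := by
        decide +kernel
      obtain ⟨d, hd⟩ := h2 χ
      obtain ⟨w, rfl⟩ := hs d
      exact hd (DFunLike.congr_fun this w)
    · have : φ = ((dihedralHom e c).comp (proj i)).comp freeMap := by
        ext j
        fin_cases j
        · simpa [freeMap] using! h0.symm
        · simpa [freeMap] using! h1.symm
      rw [this]
      simp [MonoidHom.mem_ker.1 hw]
  · intro w hw
    rw [freeKernel, Subgroup.mem_sInf] at hw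
    have h : ∀ i, proj i (freeMap w) = 1 := fun i => by
      have := hw (((proj i).comp freeMap).ker) ⟨inferInstance,
        ⟨QuotientGroup.quotientKerEquivOfSurjective _
          ((proj_surjective i).comp freeMap_surjective)⟩⟩
      exact this
    exact Subtype.ext (Prod.ext (h 2) (Prod.ext (h 0) (h 1)))

theorem nonempty_quotient_freeKernel :
    Nonempty (FreeGroup (Fin 2) ⧸ freeKernel ≃* X) :=
  ⟨(QuotientGroup.quotientMulEquivOfEq ker_freeMap.symm).trans
    (QuotientGroup.quotientKerEquivOfSurjective _ freeMap_surjective)⟩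

/-! ### Existence of the modules -/

/-- The faithful representation of `D8` by integral monomial matrices, modulo three. -/
def dihedralMatrix : D8 →* Matrix (Fin 2) (Fin 2) (ZMod 3) where
  toFun g := match g with
    | .r i => !![0, -1; 1, 0] ^ i.val
    | .sr i => !![1, 0; 0, -1] * !![0, -1; 1, 0] ^ i.val
  map_one' := by decide +kernel
  map_mul' := by decide +kernel

/-- The representations of `X` obtained from `dihedralMatrix` and the three projections. -/
def moduleTriple (i : Fin 3) : Representation (ZMod 3) X (Fin 2 → ZMod 3) :=
  (Matrix.toLinAlgEquiv' : _ ≃ₐ[ZMod 3] _).toMonoidHom.comp (dihedralMatrix.comp (proj i))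

theorem moduleTriple_apply (i : Fin 3) (x : X) (v : Fin 2 → ZMod 3) :
    moduleTriple i x v = (dihedralMatrix (proj i x)).mulVec v := rfl

theorem isModuleTriple_moduleTriple : IsModuleTriple moduleTriple := by
  intro i
  refine ⟨?_, by simp, ?_⟩
  -- The rotation has characteristic polynomial $t^2+1$, which has no root modulo 3, so it has no
  -- eigenvector.
  · have key : ∀ w : Fin 2 → ZMod 3, w ≠ 0 → ∀ u, ∃ s t : ZMod 3,
        u = s • w + t • (dihedralMatrix a).mulVec w := by decide +kernel
    have hne : (⊥ : Subrepresentation (moduleTriple i)) ≠ ⊤ := by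
      intro h
      have : (⊥ : Submodule (ZMod 3) (Fin 2 → ZMod 3)) = ⊤ :=
        congrArg Subrepresentation.toSubmodule h
      exact bot_ne_top this
    refine { exists_pair_ne := ⟨⊥, ⊤, hne⟩, eq_bot_or_eq_top := fun W => ?_ }
    by_cases hW : W.toSubmodule = ⊥
    · exact Or.inl (Subrepresentation.toSubmodule_injective hW)
    · right
      apply Subrepresentation.toSubmodule_injective
      obtain ⟨w, hw, h0⟩ := Submodule.exists_mem_ne_zero_of_ne_bot hW
      refine top_unique fun u _ => ?_
      obtain ⟨s, t, rfl⟩ := key w h0 u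
      obtain ⟨x, hx⟩ := proj_surjective i a
      refine add_mem (Submodule.smul_mem _ _ hw) (Submodule.smul_mem _ _ ?_)
      have := W.apply_mem_toSubmodule x hw
      rwa [moduleTriple_apply, hx] at this
  · rw [← ker_proj]
    ext x
    have hinj : ∀ d : D8, dihedralMatrix d = 1 → d = 1 := by decide +kernel
    rw [MonoidHom.mem_ker, MonoidHom.mem_ker]
    constructor
    · intro h
      apply hinj
      apply (Matrix.toLinAlgEquiv' : _ ≃ₐ[ZMod 3] _).injective
      rw [map_one]
      exact h
    · intro h
      simp [moduleTriple, h]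

/-! ### Invariance under isomorphism -/

section Congr

variable {G H : Type*} [Group G] [Group H]

theorem mapSubgroup_sInf (e : G ≃* H) (T : Set (Subgroup G)) :
    sInf (e.mapSubgroup '' T) = e.mapSubgroup (sInf T) := by
  rw [map_sInf, sInf_image]

theorem alpha_le_of_mulEquiv (e : G ≃* H) : alpha H ≤ alpha G := by
  obtain ⟨T, hT, hf, hc⟩ := exists_ncard_eq_alpha G
  refine Nat.sInf_le ⟨e.mapSubgroup '' T, ?_, ?_, ?_⟩
  · rintro _ ⟨K, hK, rfl⟩
    exact (e.mapSubgroup.isCoatom_iff K).2 (hT K hK)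
  · rw [mapSubgroup_sInf, hf, frattini, frattini, OrderIso.map_radical]
  · rw [Set.ncard_image_of_injective _ e.mapSubgroup.injective, hc]

theorem IsIrredundant.image (e : G ≃* H) {M : Set (Subgroup G)} (hM : IsIrredundant M) :
    IsIrredundant (e.mapSubgroup '' M) := by
  refine ⟨?_, fun T hT h => ?_⟩
  · rintro _ ⟨K, hK, rfl⟩
    exact (e.mapSubgroup.isCoatom_iff K).2 (hM.1 K hK)
  · obtain ⟨T, rfl⟩ := e.mapSubgroup.surjective.image_surjective T
    rw [mapSubgroup_sInf, mapSubgroup_sInf] at h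
    exact hM.2 T ⟨(Set.image_subset_image_iff e.mapSubgroup.injective).1 hT.1,
      fun h' => hT.2 (Set.image_mono h')⟩
      (e.mapSubgroup.injective h)

theorem isMaximalIrredundant_image (e : G ≃* H) {M : Set (Subgroup G)}
    (hM : IsMaximalIrredundant M) : IsMaximalIrredundant (e.mapSubgroup '' M) := by
  refine ⟨hM.1.image e, fun S hS h => ?_⟩
  obtain ⟨S, rfl⟩ := e.mapSubgroup.surjective.image_surjective S
  have hS' : IsIrredundant S := by
    have := hS.image e.symm
    rwa [show (e.symm.mapSubgroup : Subgroup H → Subgroup G) = e.mapSubgroup.symm from rfl,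
      Set.image_image, Set.image_congr (fun x _ => e.mapSubgroup.symm_apply_apply x),
      Set.image_id'] at this
  exact Set.image_mono (hM.2 hS' ((Set.image_subset_image_iff e.mapSubgroup.injective).1 h))

theorem Mindim_le_of_mulEquiv [Finite G] (e : G ≃* H) : Mindim H ≤ Mindim G := by
  obtain ⟨M, hM, hc⟩ := exists_ncard_eq_Mindim G
  refine Nat.sInf_le ⟨_, isMaximalIrredundant_image e hM, ?_⟩
  rw [Set.ncard_image_of_injective _ e.mapSubgroup.injective, hc]

theorem IsIrredundant.exists_mem_notMem {S : Set (Subgroup G)} (hS : IsIrredundant S)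
    {K : Subgroup G} (hK : K ∈ S) : ∃ g, (∀ L ∈ S, L ≠ K → g ∈ L) ∧ g ∉ K := by
  have h := hS.2 (S \ {K}) (Set.sdiff_singleton_ssubset.2 hK)
  by_contra! hc
  refine h (le_antisymm (le_sInf fun L hL => ?_) (sInf_le_sInf Set.sdiff_subset))
  by_cases hLK : L = K
  · subst hLK
    exact fun g hg => hc g fun L hL hne => Subgroup.mem_sInf.1 hg L ⟨hL, hne⟩
  · exact sInf_le ⟨hL, hLK⟩

end Congr

/-! ### Elements of `X` and their action on irreducible modules -/

/-- Involutions of the Frattini subgroup of `X`; the `i`-th one lies in `N j` for `j ≠ i`. -/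
def centralInvolution : Fin 3 → X := ![y₁ * y₂ * y₃, y₂, y₁]

/-- Square roots of the elements `centralInvolution i`. -/
def centralRoot : Fin 3 → X := ![x₁ * x₂, x₂, x₁]

/-- The two homomorphisms to a group of order two that correspond to the generators `x₂`, `x₁`. -/
def parity (j : Fin 2) : X →* Multiplicative (ZMod 2) :=
  reflParity.comp (proj (![2, 1] j))

theorem centralRoot_mul_self (i : Fin 3) :
    centralRoot i * centralRoot i = centralInvolution i := by
  revert i; decide +kernel

theorem centralInvolution_mul_self (i : Fin 3) :
    centralInvolution i * centralInvolution i = 1 := by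
  revert i; decide +kernel

theorem centralInvolution_comm (i : Fin 3) (x : X) :
    centralInvolution i * x = x * centralInvolution i := by
  have : ∀ i, ∀ x : {g : D8 × D8 × D8 // g ∈ X},
    centralInvolution i * x = x * centralInvolution i := by decide +kernel
  exact this i x

theorem proj_centralInvolution (i j : Fin 3) :
    proj j (centralInvolution i) = 1 ↔ j ≠ i := by
  revert i j; decide +kernel

theorem parity_generator (i j : Fin 2) : parity i (![x₂, x₁] j) = 1 ↔ i ≠ j := by
  revert i j; decide +kernel

theorem exists_pow_centralInvolution (x : X) (h : ∀ j, parity j x = 1) :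
    ∃ k : Fin 3 → Fin 2, x = centralInvolution 0 ^ (k 0).val *
      centralInvolution 1 ^ (k 1).val * centralInvolution 2 ^ (k 2).val := by
  have : ∀ x : {g : D8 × D8 × D8 // g ∈ X}, (∀ j, parity j x = 1) →
      ∃ k : Fin 3 → Fin 2, x = centralInvolution 0 ^ (k 0).val *
        centralInvolution 1 ^ (k 1).val * centralInvolution 2 ^ (k 2).val := by decide +kernel
  exact this x h

/-- The three central involutions generate the common kernel of the parities, so containment of its
image need only be tested on them. -/
theorem map_mem_of_parity {Γ : Type*} [Group Γ] (f : X →* Γ) (K : Subgroup Γ)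
    (hK : ∀ i, f (centralInvolution i) ∈ K) {x : X} (h : ∀ j, parity j x = 1) : f x ∈ K := by
  obtain ⟨k, rfl⟩ := exists_pow_centralInvolution x h
  rw [map_mul, map_mul, map_pow, map_pow, map_pow]
  exact mul_mem (mul_mem (pow_mem (hK 0) _) (pow_mem (hK 1) _)) (pow_mem (hK 2) _)

section Irreducible

variable {V : Type*} [AddCommGroup V] [Module (ZMod 3) V]

theorem three_smul_eq (v : V) : v + v + v = 0 := by
  have : ((1 + 1 + 1 : ZMod 3)) • v = 0 := by
    rw [show (1 + 1 + 1 : ZMod 3) = 0 from by decide, zero_smul]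
  simpa [add_smul] using this

theorem add_self_eq_neg (v : V) : v + v = -v := eq_neg_of_add_eq_zero_left (three_smul_eq v)

variable {Q : Type*} [Group Q] {ρ : Representation (ZMod 3) Q V}

/-- Over a prime field every additive subgroup is a subspace. -/
theorem addSubgroup_eq_bot_or_eq_top (hρ : ρ.IsIrreducible) (S : AddSubgroup V)
    (hS : ∀ x, ∀ v ∈ S, ρ x v ∈ S) : S = ⊥ ∨ S = ⊤ := by
  let W : Subrepresentation ρ := ⟨AddSubgroup.toZModSubmodule 3 S, fun x v hv => hS x v hv⟩
  rcases hρ.eq_bot_or_eq_top W with h | h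
  · left
    refine (AddSubgroup.eq_bot_iff_forall S).2 fun v hv => ?_
    have hv : v ∈ W := hv
    rw [h] at hv
    exact hv
  · right
    refine top_unique fun v _ => ?_
    have : v ∈ W := h ▸ (Submodule.mem_top : v ∈ (⊤ : Submodule (ZMod 3) V))
    exact this

theorem map_eq_neg_of_central_involution (hρ : ρ.IsIrreducible) {z : Q} (hz : z * z = 1)
    (hc : ∀ x, z * x = x * z) (h1 : ρ z ≠ 1) (v : V) : ρ z v = -v := by
  have hmul : ∀ x y u, ρ x (ρ y u) = ρ (x * y) u := fun x y u => by rw [map_mul]; rfl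
  let S : AddSubgroup V := ((ρ z).toAddMonoidHom - AddMonoidHom.id V).ker
  have hmem : ∀ u, u ∈ S ↔ ρ z u = u := fun u => sub_eq_zero
  rcases addSubgroup_eq_bot_or_eq_top hρ S (fun x u hu => by
    rw [hmem] at hu ⊢
    rw [hmul, hc, ← hmul, hu]) with h | h
  -- The fixed space is invariant because $z$ is central. When it is zero, the fixed vector $v+zv$
  -- vanishes.
  · have : v + ρ z v ∈ S := by
      rw [hmem, map_add, hmul, hz, map_one, Module.End.one_apply, add_comm]
    rw [h, AddSubgroup.mem_bot] at this
    exact eq_neg_of_add_eq_zero_right this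
  · refine absurd (LinearMap.ext fun u => ?_) h1
    exact (hmem u).1 (h ▸ AddSubgroup.mem_top u)

/-- Otherwise the line spanned by $v$ would be a proper nonzero submodule. -/
theorem exists_map_ne (hρ : ρ.IsIrreducible) (hd : Module.finrank (ZMod 3) V = 2) {v : V}
    (hv : v ≠ 0) : ∃ x, ρ x v ≠ v ∧ ρ x v ≠ -v := by
  by_contra! hc
  rcases addSubgroup_eq_bot_or_eq_top hρ (AddSubgroup.zmultiples v) (fun x u hu => by
    obtain ⟨n, rfl⟩ := AddSubgroup.mem_zmultiples_iff.1 hu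
    rw [map_zsmul]
    refine zsmul_mem ?_ _
    by_cases h : ρ x v = v
    · rw [h]
      exact AddSubgroup.mem_zmultiples v
    · rw [hc x h]
      exact neg_mem (AddSubgroup.mem_zmultiples v)) with h | h
  · exact hv (AddSubgroup.zmultiples_eq_bot.1 h)
  · have := finrank_le_one (R := ZMod 3) v fun w => by
      obtain ⟨n, rfl⟩ := AddSubgroup.mem_zmultiples_iff.1 (h ▸ AddSubgroup.mem_top w)
      exact ⟨n, Int.cast_smul_eq_zsmul _ _ _⟩
    omega

end Irreducible

section Triple

variable {A : Fin 3 → Type*} [∀ i, AddCommGroup (A i)] [∀ i, Module (ZMod 3) (A i)]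
  {ρ : ∀ i, Representation (ZMod 3) X (A i)}

theorem rho_eq_one_iff (hρ : IsModuleTriple ρ) (i : Fin 3) (x : X) :
    ρ i x = 1 ↔ proj i x = 1 := by
  rw [← MonoidHom.mem_ker, (hρ i).2.2, ← ker_proj, MonoidHom.mem_ker]

theorem rho_centralInvolution_self (hρ : IsModuleTriple ρ) (i : Fin 3) (v : A i) :
    ρ i (centralInvolution i) v = -v :=
  map_eq_neg_of_central_involution (hρ i).1 (centralInvolution_mul_self i)
    (centralInvolution_comm i)
    (fun h => (proj_centralInvolution i i).1 ((rho_eq_one_iff hρ i _).1 h) rfl) v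

theorem rho_centralInvolution_of_ne (hρ : IsModuleTriple ρ) {i j : Fin 3} (h : j ≠ i) (v : A j) :
    ρ j (centralInvolution i) v = v := by
  rw [(rho_eq_one_iff hρ j _).2 ((proj_centralInvolution i j).2 h)]
  rfl

/-- The stabilizer of a nonzero vector does not map onto the abelianization of `X`. -/
theorem parity_stabilizer (hρ : IsModuleTriple ρ) (i : Fin 3) {v : A i} (hv : v ≠ 0)
    {x : Fin 2 → X} (hx : ∀ j, ρ i (x j) v = v) (h : ∀ j l, parity l (x j) = 1 ↔ l ≠ j) : False := by
  obtain ⟨g, hg, hg'⟩ := exists_map_ne (hρ i).1 (hρ i).2.1 hv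
  -- The stabilizer of the pair $\{v,-v\}$ contains the common kernel of the parities; with the
  -- elements `x j` it is all of $X$, which contradicts the choice of `g`.
  let H : Subgroup X :=
    { carrier := {g | ρ i g v = v ∨ ρ i g v = -v}
      one_mem' := Or.inl (by simp)
      mul_mem' := by
        rintro g h (hg | hg) (hh | hh) <;> simp [hg, hh]
      inv_mem' := by
        rintro g (hg | hg)
        · left
          conv_lhs => rw [← hg]
          simp
        · right
          rw [eq_neg_iff_add_eq_zero, ← neg_eq_iff_add_eq_zero, ← map_neg, ← hg]
          simp }
  have hF : ∀ f, (∀ j, parity j f = 1) → f ∈ H := fun f hf =>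
    map_mem_of_parity (MonoidHom.id X) H (fun j => by
      by_cases hj : i = j
      · subst hj
        exact Or.inr (rho_centralInvolution_self hρ i v)
      · exact Or.inl (rho_centralInvolution_of_ne hρ hj v)) hf
  have hxH : ∀ j, x j ∈ H := fun j => Or.inl (hx j)
  have h2 : ∀ s t : Multiplicative (ZMod 2), s ≠ 1 → t ≠ 1 → s⁻¹ * t = 1 := by decide
  have key : ∀ j, ∀ g, ∃ g', (g' ∈ H → g ∈ H) ∧ parity j g' = 1 ∧
      ∀ l, l ≠ j → parity l g' = parity l g := by
    intro j g
    by_cases hj : parity j g = 1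
    · exact ⟨g, id, hj, fun _ _ => rfl⟩
    · refine ⟨(x j)⁻¹ * g, fun hg => ?_, ?_, fun l hl => ?_⟩
      · simpa using mul_mem (hxH j) hg
      · rw [map_mul, map_inv]
        exact h2 _ _ (fun h' => (h j j).1 h' rfl) hj
      · rw [map_mul, map_inv, (h j l).2 hl, inv_one, one_mul]
  obtain ⟨g₁, h1, h3, -⟩ := key 0 g
  obtain ⟨g₂, h4, h5, h6⟩ := key 1 g₁
  have : g ∈ H := h1 (h4 (hF g₂ fun j => by
    fin_cases j
    · exact (h6 0 (by decide)).trans h3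
    · exact h5))
  exact this.elim hg hg'

end Triple

/-! ### Direct powers of the semidirect product -/

section Power

variable {A : Fin 3 → Type*} [∀ i, AddCommGroup (A i)] [∀ i, Module (ZMod 3) (A i)]
  {ρ : ∀ i, Representation (ZMod 3) X (A i)}

theorem ext_semiProd {g h : SemiProd ρ} (hl : ∀ i, g.left.toAdd i = h.left.toAdd i)
    (hr : g.right = h.right) : g = h :=
  SemidirectProduct.ext (Multiplicative.toAdd.injective (funext hl)) hr

theorem mul_left_apply (g h : SemiProd ρ) (i : Fin 3) :
    (g * h).left.toAdd i = g.left.toAdd i + ρ i g.right (h.left.toAdd i) := rfl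

theorem inv_left_apply (g : SemiProd ρ) (i : Fin 3) :
    g⁻¹.left.toAdd i = ρ i g.right⁻¹ (-g.left.toAdd i) := rfl

variable (ρ) in
/-- The inclusion of the `i`-th module into the semidirect product. -/
def incl (i : Fin 3) (u : A i) : SemiProd ρ :=
  SemidirectProduct.inl (Multiplicative.ofAdd (Pi.single i u))

theorem incl_left_apply (i j : Fin 3) (u : A i) :
    (incl ρ i u).left.toAdd j = (Pi.single i u : ∀ i, A i) j := rfl

theorem incl_right (i : Fin 3) (u : A i) : (incl ρ i u).right = 1 := rfl

theorem inr_left_apply (x : X) (j : Fin 3) :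
    (SemidirectProduct.inr x : SemiProd ρ).left.toAdd j = 0 := rfl

theorem incl_add (i : Fin 3) (u v : A i) : incl ρ i (u + v) = incl ρ i u * incl ρ i v := by
  rw [incl, Pi.single_add, ofAdd_add, map_mul]
  rfl

theorem incl_zero (i : Fin 3) : incl ρ i 0 = 1 := by
  rw [incl, Pi.single_zero, ofAdd_zero, map_one]

theorem mul_incl (i : Fin 3) (u : A i) (g : SemiProd ρ) :
    g * incl ρ i u = incl ρ i (ρ i g.right u) * g := by
  refine ext_semiProd (fun j => ?_) ?_
  · rw [mul_left_apply, mul_left_apply, incl_left_apply, incl_left_apply, incl_right, map_one,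
      Module.End.one_apply, add_comm]
    congr 1
    by_cases h : j = i
    · subst h
      simp
    · simp [h]
  · rw [SemidirectProduct.mul_right, SemidirectProduct.mul_right, incl_right, incl_right, one_mul,
      mul_one]

/-- The $i$-th coordinate $v$ of $g$ becomes $-v=v+v$ in characteristic 3, so the commutator of the
involution with $g$ is exactly that coordinate. -/
theorem inr_centralInvolution_mul (hρ : IsModuleTriple ρ) (i : Fin 3) (g : SemiProd ρ) :
    SemidirectProduct.inr (centralInvolution i) * g =
      incl ρ i (g.left.toAdd i) * g * SemidirectProduct.inr (centralInvolution i) := by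
  refine ext_semiProd (fun j => ?_) ?_
  · simp only [mul_left_apply, incl_left_apply, incl_right, inr_left_apply, map_one,
      SemidirectProduct.right_inr, map_zero, zero_add, add_zero, Module.End.one_apply]
    by_cases h : j = i
    · subst h
      rw [rho_centralInvolution_self hρ, Pi.single_eq_same, add_self_eq_neg]
    · rw [rho_centralInvolution_of_ne hρ h, Pi.single_eq_of_ne h, zero_add]
  · simp only [SemidirectProduct.mul_right, incl_right, one_mul, SemidirectProduct.right_inr]
    exact centralInvolution_comm i _

theorem isCoatom_comap_eval {ι : Type*} {H : Subgroup (SemiProd ρ)} (hH : IsCoatom H) (c : ι) :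
    IsCoatom (H.comap (Pi.evalMonoidHom (fun _ : ι => SemiProd ρ) c)) :=
  Subgroup.isCoatom_comap_of_surjective (Function.surjective_eval c) hH

variable {ι : Type*} [DecidableEq ι]

variable (ρ) in
/-- The inclusion of the `i`-th module of the factor `c` into the direct power. -/
def emb (c : ι) (i : Fin 3) (u : A i) : ι → SemiProd ρ := Pi.mulSingle c (incl ρ i u)

variable (ρ) in
/-- The inclusion of the group `X` of the factor `c` into the direct power. -/
def embX (c : ι) : X →* (ι → SemiProd ρ) :=
  (MonoidHom.mulSingle (fun _ : ι => SemiProd ρ) c).comp SemidirectProduct.inr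

theorem embX_apply (c : ι) (x : X) :
    embX ρ c x = Pi.mulSingle c (SemidirectProduct.inr x) := rfl

theorem emb_add (c : ι) (i : Fin 3) (u v : A i) :
    emb ρ c i (u + v) = emb ρ c i u * emb ρ c i v := by
  rw [emb, incl_add, Pi.mulSingle_mul]
  rfl

theorem emb_zero (c : ι) (i : Fin 3) : emb ρ c i 0 = 1 := by
  rw [emb, incl_zero, Pi.mulSingle_one]

theorem emb_neg (c : ι) (i : Fin 3) (u : A i) : emb ρ c i (-u) = (emb ρ c i u)⁻¹ := by
  rw [eq_inv_iff_mul_eq_one, ← emb_add, neg_add_cancel, emb_zero]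

theorem mul_emb (c : ι) (i : Fin 3) (u : A i) (g : ι → SemiProd ρ) :
    g * emb ρ c i u = emb ρ c i (ρ i (g c).right u) * g := by
  funext d
  by_cases h : d = c
  · subst h
    simpa [emb] using mul_incl i u (g d)
  · simp [emb, h]

theorem embX_centralInvolution_mul (hρ : IsModuleTriple ρ) (c : ι) (i : Fin 3)
    (g : ι → SemiProd ρ) : embX ρ c (centralInvolution i) * g =
      emb ρ c i ((g c).left.toAdd i) * g * embX ρ c (centralInvolution i) := by
  funext d
  by_cases h : d = c
  · subst h
    simpa [emb, embX_apply] using inr_centralInvolution_mul hρ i (g d)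
  · simp [emb, embX_apply, h]

/-- `K` does not contain the `i`-th module of the factor `c`. -/
def Misses (K : Subgroup (ι → SemiProd ρ)) (c : ι) (i : Fin 3) : Prop :=
  ∃ u, emb ρ c i u ∉ K

/-! ### Maximal subgroups of the direct power -/

section Coatom

variable {K : Subgroup (ι → SemiProd ρ)} {c : ι} {i : Fin 3}

variable (ρ) in
/-- The image of `emb`. -/
def embRange (c : ι) (i : Fin 3) : Subgroup (ι → SemiProd ρ) where
  carrier := Set.range (emb ρ c i)
  one_mem' := ⟨0, emb_zero c i⟩
  mul_mem' := by
    rintro _ _ ⟨u, rfl⟩ ⟨v, rfl⟩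
    exact ⟨u + v, emb_add c i u v⟩
  inv_mem' := by
    rintro _ ⟨u, rfl⟩
    exact ⟨-u, emb_neg c i u⟩

instance embRange_normal (c : ι) (i : Fin 3) : (embRange ρ c i).Normal where
  conj_mem := by
    rintro _ ⟨u, rfl⟩ g
    exact ⟨ρ i (g c).right u, by rw [mul_emb, mul_inv_cancel_right]⟩

theorem exists_mul_emb_mem (hK : IsCoatom K) (h : Misses K c i) (g : ι → SemiProd ρ) :
    ∃ u, g * emb ρ c i u ∈ K := by
  obtain ⟨u, hu⟩ := h
  have htop : K ⊔ embRange ρ c i = ⊤ := by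
    refine hK.2 _ (lt_of_le_of_ne le_sup_left fun h => hu ?_)
    rw [h]
    exact (le_sup_right : embRange ρ c i ≤ _) ⟨u, rfl⟩
  obtain ⟨m, hm, _, ⟨v, rfl⟩, hmv⟩ :=
    Subgroup.mem_sup_of_normal_right.1 (htop ▸ Subgroup.mem_top g)
  refine ⟨-v, ?_⟩
  rwa [← hmv, emb_neg, mul_inv_cancel_right]

/-- The trace of $K$ on the module is $X$-invariant: each $x$ can be corrected by a module element
to lie in $K$, and the correction commutes with the module. Irreducibility leaves only zero. -/
theorem eq_zero_of_emb_mem (hρ : IsModuleTriple ρ) (hK : IsCoatom K) (h : Misses K c i) {u : A i}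
    (hu : emb ρ c i u ∈ K) : u = 0 := by
  let S : AddSubgroup (A i) :=
    { carrier := {u | emb ρ c i u ∈ K}
      zero_mem' := by
        change emb ρ c i 0 ∈ K
        rw [emb_zero]
        exact one_mem K
      add_mem' := fun {u v} hu hv => by
        change emb ρ c i (u + v) ∈ K
        rw [emb_add]
        exact mul_mem hu hv
      neg_mem' := fun {u} hu => by
        change emb ρ c i (-u) ∈ K
        rw [emb_neg]
        exact inv_mem hu }
  rcases addSubgroup_eq_bot_or_eq_top (hρ i).1 S (fun x v hv => by
    obtain ⟨w, hw⟩ := exists_mul_emb_mem hK h (embX ρ c x)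
    have h1 := mul_mem (mul_mem hw hv) (inv_mem hw)
    rw [mul_assoc (embX ρ c x), ← emb_add, add_comm, emb_add, ← mul_assoc, mul_emb c i v] at h1
    have h2 : (embX ρ c x c).right = x := by simp [embX_apply]
    rw [h2] at h1
    change emb ρ c i _ ∈ K
    convert h1 using 1
    group) with hS | hS
  · exact (AddSubgroup.mem_bot).1 (hS ▸ (show u ∈ S from hu))
  · obtain ⟨v, hv⟩ := h
    exact absurd (show v ∈ S from hS ▸ AddSubgroup.mem_top v) hv

theorem misses_unique (hρ : IsModuleTriple ρ) (hK : IsCoatom K) (h : Misses K c i) {c' : ι}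
    {i' : Fin 3} (h' : Misses K c' i') : c = c' ∧ i = i' := by
  by_contra hne
  obtain ⟨u', hu'⟩ := h'
  obtain ⟨u, hu⟩ := exists_mul_emb_mem hK h (emb ρ c' i' u')
  obtain ⟨w, hw⟩ := exists_mul_emb_mem hK h (embX ρ c' (centralInvolution i'))
  have h0 : ((emb ρ c' i' u' * emb ρ c i u) c').left.toAdd i' = u' := by
    rw [Pi.mul_apply, mul_left_apply]
    have h1 : (emb ρ c' i' u' c').left.toAdd i' = u' := by simp [emb, incl_left_apply]
    have h2 : (emb ρ c i u c').left.toAdd i' = 0 := by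
      by_cases hc : c' = c
      · subst hc
        have hi : i' ≠ i := fun hi => hne ⟨rfl, hi.symm⟩
        simp [emb, incl_left_apply, hi]
      · simp [emb, hc]
    rw [h1, h2, map_zero, add_zero]
  have h3 := embX_centralInvolution_mul hρ c' i' (emb ρ c' i' u' * emb ρ c i u)
  rw [h0] at h3
  have h4 : (emb ρ c' i' u' * emb ρ c i u) * emb ρ c i w =
      emb ρ c i w * (emb ρ c' i' u' * emb ρ c i u) := by
    have h5 : emb ρ c' i' u' * emb ρ c i w = emb ρ c i w * emb ρ c' i' u' := by
      rw [mul_emb]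
      have : (emb ρ c' i' u' c).right = 1 := by
        by_cases hc : c = c'
        · subst hc
          simp [emb, incl_right]
        · simp [emb, hc]
      rw [this, map_one]
      rfl
    rw [mul_assoc, ← emb_add, add_comm, emb_add, ← mul_assoc, h5, mul_assoc]
  -- Since $w$ commutes with $g=u'u$, the commutator of $zw$ and $g$ is that of $z$ and $g$, hence
  -- $u'$.
  have h6 := mul_mem (mul_mem (mul_mem hw hu) (inv_mem hw)) (inv_mem hu)
  rw [mul_assoc _ _ (emb ρ c' i' u' * emb ρ c i u), ← h4, ← mul_assoc, h3] at h6
  apply hu'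
  convert h6 using 1
  group

theorem embX_mem_of_not_misses (hρ : IsModuleTriple ρ) (hK : IsCoatom K) (h : ¬ Misses K c i) :
    embX ρ c (centralInvolution i) ∈ K := by
  have hE : ∀ u, emb ρ c i u ∈ K := fun u => by
    by_contra hu
    exact h ⟨u, hu⟩
  by_contra hz
  set z := embX ρ c (centralInvolution i) with hz_def
  set s := embX ρ c (centralRoot i) with hs_def
  have hss : s * s = z := by rw [hs_def, ← map_mul, centralRoot_mul_self]
  have hzz : z * z = 1 := by rw [hz_def, ← map_mul, centralInvolution_mul_self, map_one]
  have hconj : ∀ m ∈ K, z * m * z⁻¹ ∈ K := fun m hm => by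
    rw [hz_def, embX_centralInvolution_mul hρ, mul_inv_cancel_right]
    exact mul_mem (hE _) hm
  have hn : z ∈ Subgroup.normalizer (K : Set (ι → SemiProd ρ)) := by
    rw [Subgroup.mem_normalizer_iff]
    refine fun m => ⟨hconj m, fun hm => ?_⟩
    have := hconj _ hm
    have hi : z⁻¹ = z := inv_eq_of_mul_eq_one_right hzz
    rw [hi] at this
    have h3 : z * (z * m * z) * z = m := by
      calc z * (z * m * z) * z = (z * z) * m * (z * z) := by group
        _ = m := by rw [hzz, one_mul, mul_one]
    rwa [h3] at this
  -- The normalizer contains $K$ and also $z\notin K$, so by maximality it is everything.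
  have hnorm : K.Normal := by
    rw [← Subgroup.normalizer_eq_top_iff]
    exact hK.2 _ (lt_of_le_of_ne Subgroup.le_normalizer fun h => hz (h ▸ hn))
  have htop : K ⊔ Subgroup.zpowers z = ⊤ :=
    hK.2 _ (lt_of_le_of_ne le_sup_left fun h => hz (by
      rw [h]
      exact (le_sup_right : Subgroup.zpowers z ≤ _) (Subgroup.mem_zpowers z)))
  obtain ⟨m, hm, w, hw, hmw⟩ :=
    Subgroup.mem_sup_of_normal_left.1 (htop ▸ Subgroup.mem_top s)
  obtain ⟨n, rfl⟩ := Subgroup.mem_zpowers_iff.1 hw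
  apply hz
  have h1 : z ^ n * z ^ n = 1 := by rw [← (Commute.refl z).mul_zpow, hzz, one_zpow]
  -- Squaring $s=mz^n$ writes $z$ as a product of $m$ and a conjugate of $m$.
  have h2 : z = m * (z ^ n * m * (z ^ n)⁻¹) := by
    calc z = m * z ^ n * (m * z ^ n) := by rw [hmw, hss]
      _ = m * (z ^ n * m * (z ^ n)⁻¹) := by
        rw [inv_eq_of_mul_eq_one_right h1]
        simp only [mul_assoc]
  rw [h2]
  exact mul_mem hm (hnorm.conj_mem m hm _)

theorem emb_mem_of_not_misses (h : ¬ Misses K c i) (u : A i) : emb ρ c i u ∈ K := by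
  by_contra hu
  exact h ⟨u, hu⟩

end Coatom

/-! ### The lower bound for `alpha` -/

theorem exists_two_misses (hρ : IsModuleTriple ρ) {T : Set (Subgroup (ι → SemiProd ρ))}
    (hT : ∀ K ∈ T, IsCoatom K) (hinf : sInf T = ⊥) (c : ι) (i : Fin 3) :
    ∃ K ∈ T, ∃ L ∈ T, K ≠ L ∧ Misses K c i ∧ Misses L c i := by
  have hnt : embX ρ c (centralInvolution i) ∉ embRange ρ c i := by
    rintro ⟨u, hu⟩
    have := congrArg (fun g => (g c).right) hu
    simp only [emb, embX_apply, Pi.mulSingle_eq_same, incl_right, SemidirectProduct.right_inr]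
      at this
    refine (proj_centralInvolution i i).1 ?_ rfl
    rw [← this, map_one]
  have hmem : ∀ g, (∀ K ∈ T, g ∈ K) → g = 1 := fun g hg => by
    rw [← Subgroup.mem_bot, ← hinf]
    exact Subgroup.mem_sInf.2 hg
  by_contra! hc
  -- The only member that can miss the module dictates $u$; every other member contains both
  -- factors. If none misses it, $u=0$ serves.
  have hall : ∃ u, ∀ K ∈ T, embX ρ c (centralInvolution i) * emb ρ c i u ∈ K := by
    by_cases h : ∃ K ∈ T, Misses K c i
    · obtain ⟨K, hK, hm⟩ := h
      obtain ⟨u, hu⟩ := exists_mul_emb_mem (hT K hK) hm (embX ρ c (centralInvolution i))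
      refine ⟨u, fun L hL => ?_⟩
      by_cases hKL : K = L
      · exact hKL ▸ hu
      · have := hc K hK L hL hKL hm
        exact mul_mem (embX_mem_of_not_misses hρ (hT L hL) this) (emb_mem_of_not_misses this u)
    · refine ⟨0, fun L hL => ?_⟩
      have : ¬ Misses L c i := fun hm => h ⟨L, hL, hm⟩
      exact mul_mem (embX_mem_of_not_misses hρ (hT L hL) this) (emb_mem_of_not_misses this 0)
  obtain ⟨u, hu⟩ := hall
  apply hnt
  rw [eq_inv_of_mul_eq_one_left (hmem _ hu)]
  exact inv_mem ⟨u, rfl⟩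

variable (ρ) in
/-- The stabilizer of the vector `v` in the affine action on the `i`-th module. -/
def pointStabilizer (i : Fin 3) (v : A i) : Subgroup (SemiProd ρ) where
  carrier := {g | g.left.toAdd i + ρ i g.right v = v}
  one_mem' := by simp
  mul_mem' := fun {g h} hg hh => by
    have hg : g.left.toAdd i + ρ i g.right v = v := hg
    have hh : h.left.toAdd i + ρ i h.right v = v := hh
    change (g * h).left.toAdd i + ρ i (g * h).right v = v
    rw [mul_left_apply, SemidirectProduct.mul_right, map_mul, Module.End.mul_apply, add_assoc,
      ← map_add, hh, hg]
  inv_mem' := fun {g} hg => by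
    have hg : g.left.toAdd i + ρ i g.right v = v := hg
    change g⁻¹.left.toAdd i + ρ i g⁻¹.right v = v
    rw [inv_left_apply, SemidirectProduct.inv_right, ← map_add]
    have : -g.left.toAdd i + v = ρ i g.right v := by
      conv_lhs => rw [← hg]
      rw [neg_add_cancel_left]
    rw [this]
    simp

theorem mem_pointStabilizer {i : Fin 3} {v : A i} {g : SemiProd ρ} :
    g ∈ pointStabilizer ρ i v ↔ g.left.toAdd i + ρ i g.right v = v := Iff.rfl

theorem mem_pointStabilizer_zero {i : Fin 3} {g : SemiProd ρ} :
    g ∈ pointStabilizer ρ i 0 ↔ g.left.toAdd i = 0 := by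
  rw [mem_pointStabilizer, map_zero, add_zero]

theorem incl_mem_pointStabilizer {i : Fin 3} {u v : A i} :
    incl ρ i u ∈ pointStabilizer ρ i v ↔ u = 0 := by
  rw [mem_pointStabilizer, incl_left_apply, incl_right, map_one, Module.End.one_apply,
    Pi.single_eq_same, add_eq_right]

theorem exists_mul_incl_mem (i : Fin 3) (v : A i) (g : SemiProd ρ) :
    ∃ u, incl ρ i u * g ∈ pointStabilizer ρ i v := by
  refine ⟨v - (g.left.toAdd i + ρ i g.right v), ?_⟩
  rw [mem_pointStabilizer, mul_left_apply, incl_left_apply, SemidirectProduct.mul_right, incl_right,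
    one_mul, map_one, Module.End.one_apply, Pi.single_eq_same, add_assoc, sub_add_cancel]

theorem isCoatom_pointStabilizer (hρ : IsModuleTriple ρ) (i : Fin 3) (v : A i) :
    IsCoatom (pointStabilizer ρ i v) := by
  constructor
  · intro h
    have : Nontrivial (A i) := Module.nontrivial_of_finrank_pos (R := ZMod 3)
      (by rw [(hρ i).2.1]; norm_num)
    obtain ⟨u, hu⟩ := exists_ne (0 : A i)
    exact hu (incl_mem_pointStabilizer.1 (h ▸ Subgroup.mem_top (incl ρ i u)))
  · intro H hH
    let S : AddSubgroup (A i) :=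
      { carrier := {u | incl ρ i u ∈ H}
        zero_mem' := by
          change incl ρ i 0 ∈ H
          rw [incl_zero]
          exact one_mem H
        add_mem' := fun {u v} hu hv => by
          change incl ρ i (u + v) ∈ H
          rw [incl_add]
          exact mul_mem hu hv
        neg_mem' := fun {u} hu => by
          change incl ρ i (-u) ∈ H
          rw [← add_self_eq_neg, incl_add]
          exact mul_mem hu hu }
    rcases addSubgroup_eq_bot_or_eq_top (hρ i).1 S (fun x u hu => by
      obtain ⟨w, hw⟩ := exists_mul_incl_mem i v (SemidirectProduct.inr x : SemiProd ρ)
      have hw := hH.le hw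
      have h1 := mul_mem (mul_mem hw hu) (inv_mem hw)
      rw [mul_assoc (incl ρ i w), mul_incl, ← mul_assoc, ← incl_add, add_comm, incl_add] at h1
      change incl ρ i _ ∈ H
      convert h1 using 1
      simp [mul_assoc]) with hS | hS
    · obtain ⟨g, hg, hgK⟩ := Set.exists_of_ssubset hH
      obtain ⟨u, hu⟩ := exists_mul_incl_mem i v g
      have hu0 : u ∈ S := by
        change incl ρ i u ∈ H
        simpa using mul_mem (hH.le hu) (inv_mem hg)
      rw [hS, AddSubgroup.mem_bot] at hu0
      rw [hu0, incl_zero, one_mul] at hu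
      exact absurd hu hgK
    · refine top_unique fun g _ => ?_
      obtain ⟨u, hu⟩ := exists_mul_incl_mem i v g
      have hu0 : incl ρ i u ∈ H := (show u ∈ S from hS ▸ AddSubgroup.mem_top u)
      simpa using mul_mem (inv_mem hu0) (hH.le hu)

/-- An element in all point stabilizers of a factor has no translation part, since it fixes zero,
and acts trivially on all three modules; the kernels of the three actions intersect trivially. -/
theorem frattini_eq_bot {κ : Type*} (hρ : IsModuleTriple ρ) : frattini (κ → SemiProd ρ) = ⊥ := by
  refine (Subgroup.eq_bot_iff_forall _).2 fun g hg => funext fun c => ?_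
  have h : ∀ i v, g c ∈ pointStabilizer ρ i v := fun i v =>
    frattini_le_coatom (isCoatom_comap_eval (isCoatom_pointStabilizer hρ i v) c) hg
  have hl : ∀ i, (g c).left.toAdd i = 0 := fun i => mem_pointStabilizer_zero.1 (h i 0)
  refine ext_semiProd hl ?_
  have hr : ∀ i, proj i (g c).right = 1 := fun i => by
    rw [← rho_eq_one_iff hρ]
    refine LinearMap.ext fun v => ?_
    have := mem_pointStabilizer.1 (h i v)
    rwa [hl i, zero_add] at this
  exact Subtype.ext (Prod.ext (hr 2) (Prod.ext (hr 0) (hr 1)))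

theorem finite_semiProd (hρ : IsModuleTriple ρ) : Finite (SemiProd ρ) := by
  have : ∀ i, Finite (A i) := fun i => by
    have : Module.Finite (ZMod 3) (A i) :=
      Module.finite_of_finrank_pos (by rw [(hρ i).2.1]; norm_num)
    exact Module.finite_of_finite (ZMod 3)
  have : Finite (Multiplicative (∀ i, A i)) := inferInstanceAs (Finite (∀ i, A i))
  exact Finite.of_equiv _ SemidirectProduct.equivProd.symm

theorem le_alpha [Fintype ι] (hρ : IsModuleTriple ρ) :
    6 * Fintype.card ι ≤ alpha (ι → SemiProd ρ) := by
  classical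
  have := finite_semiProd hρ
  obtain ⟨T, hT, hf, hc⟩ := exists_ncard_eq_alpha (ι → SemiProd ρ)
  rw [frattini_eq_bot hρ] at hf
  choose P hP Q hQ hne hPm hQm using exists_two_misses hρ hT hf
  let f : ι × Fin 3 × Bool → T := fun t =>
    if t.2.2 then ⟨P t.1 t.2.1, hP _ _⟩ else ⟨Q t.1 t.2.1, hQ _ _⟩
  have hf : ∀ t, Misses (f t).1 t.1 t.2.1 := by
    rintro ⟨c, i, b⟩
    cases b
    · exact hQm c i
    · exact hPm c i
  have hinj : Function.Injective f := by
    rintro ⟨c, i, b⟩ ⟨c', i', b'⟩ h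
    have h1 := hf (c, i, b)
    rw [h] at h1
    obtain ⟨rfl, rfl⟩ := misses_unique hρ (hT _ (f (c', i', b')).2) h1 (hf _)
    have h2 := congrArg Subtype.val h
    cases b <;> cases b'
    · rfl
    · exact absurd h2.symm (hne _ _)
    · exact absurd h2 (hne _ _)
    · rfl
  have h := Nat.card_le_card_of_injective f hinj
  rw [Nat.card_eq_fintype_card, Nat.card_coe_set_eq, hc] at h
  simp only [Fintype.card_prod, Fintype.card_fin, Fintype.card_bool] at h
  omega

end Power

/-! ### The upper bound for `Mindim` -/

section Mindim

variable {A : Fin 3 → Type*} [∀ i, AddCommGroup (A i)] [∀ i, Module (ZMod 3) (A i)]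
  {ρ : ∀ i, Representation (ZMod 3) X (A i)}

variable (ρ) in
/-- Three complements of the modules and two subgroups of index two in the semidirect product. -/
def baseSubgroup : Fin 3 ⊕ Fin 2 → Subgroup (SemiProd ρ) :=
  Sum.elim (fun i => pointStabilizer ρ i 0)
    (fun j => (parity j).ker.comap SemidirectProduct.rightHom)

theorem mem_baseSubgroup_inl {i : Fin 3} {g : SemiProd ρ} :
    g ∈ baseSubgroup ρ (.inl i) ↔ g.left.toAdd i = 0 := mem_pointStabilizer_zero

theorem mem_baseSubgroup_inr {j : Fin 2} {g : SemiProd ρ} :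
    g ∈ baseSubgroup ρ (.inr j) ↔ parity j g.right = 1 := Iff.rfl

theorem isCoatom_ker_of_two {G : Type*} [Group G] (f : G →* Multiplicative (ZMod 2)) {g : G}
    (hg : f g ≠ 1) : IsCoatom f.ker := by
  have h2 : ∀ s t : Multiplicative (ZMod 2), s ≠ 1 → t ≠ 1 → s⁻¹ * t = 1 := by decide
  constructor
  · intro h
    exact hg (h ▸ Subgroup.mem_top g : g ∈ f.ker)
  · intro H hH
    obtain ⟨y, hy, hyf⟩ := Set.exists_of_ssubset hH
    refine top_unique fun x _ => ?_
    by_cases hx : f x = 1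
    · exact hH.le hx
    · have : y⁻¹ * x ∈ f.ker := by
        rw [MonoidHom.mem_ker, map_mul, map_inv, h2 _ _ hyf hx]
      simpa using mul_mem hy (hH.le this)

theorem isCoatom_baseSubgroup (hρ : IsModuleTriple ρ) (t : Fin 3 ⊕ Fin 2) :
    IsCoatom (baseSubgroup ρ t) := by
  rcases t with i | j
  · exact isCoatom_pointStabilizer hρ i 0
  · exact Subgroup.isCoatom_comap_of_surjective SemidirectProduct.rightHom_surjective
      (isCoatom_ker_of_two _ fun h => (parity_generator j j).1 h rfl)

theorem exists_witness (hρ : IsModuleTriple ρ) (t : Fin 3 ⊕ Fin 2) :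
    ∃ g, g ∉ baseSubgroup ρ t ∧ ∀ s, s ≠ t → g ∈ baseSubgroup ρ s := by
  rcases t with i | j
  · have : Nontrivial (A i) := Module.nontrivial_of_finrank_pos (R := ZMod 3)
      (by rw [(hρ i).2.1]; norm_num)
    obtain ⟨u, hu⟩ := exists_ne (0 : A i)
    refine ⟨incl ρ i u, fun h => hu (incl_mem_pointStabilizer.1 h), ?_⟩
    rintro (i' | j) hs
    · rw [mem_baseSubgroup_inl, incl_left_apply, Pi.single_eq_of_ne]
      exact fun h => hs (congrArg _ h)
    · rw [mem_baseSubgroup_inr, incl_right, map_one]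
  · refine ⟨SemidirectProduct.inr (![x₂, x₁] j), fun h => (parity_generator j j).1 h rfl, ?_⟩
    rintro (i | j') hs
    · rw [mem_baseSubgroup_inl, inr_left_apply]
    · exact (parity_generator j' j).2 fun h => hs (congrArg _ h)

variable {ι : Type*}

variable (ρ) in
/-- The preimage of `baseSubgroup ρ t` under the projection to the factor `c`. -/
def baseComap (p : ι × (Fin 3 ⊕ Fin 2)) : Subgroup (ι → SemiProd ρ) :=
  (baseSubgroup ρ p.2).comap (Pi.evalMonoidHom (fun _ : ι => SemiProd ρ) p.1)

theorem mem_baseComap {c : ι} {t : Fin 3 ⊕ Fin 2} {g : ι → SemiProd ρ} :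
    g ∈ baseComap ρ (c, t) ↔ g c ∈ baseSubgroup ρ t := Iff.rfl

variable [DecidableEq ι]

theorem exists_witness_comap (hρ : IsModuleTriple ρ) (p : ι × (Fin 3 ⊕ Fin 2)) :
    ∃ g, g ∉ baseComap ρ p ∧ ∀ q, q ≠ p → g ∈ baseComap ρ q := by
  obtain ⟨c, t⟩ := p
  obtain ⟨g, hg, hg'⟩ := exists_witness hρ t
  refine ⟨Pi.mulSingle c g, ?_, ?_⟩
  · rwa [mem_baseComap, Pi.mulSingle_eq_same]
  · rintro ⟨c', t'⟩ h
    rw [mem_baseComap]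
    by_cases hc : c' = c
    · subst hc
      rw [Pi.mulSingle_eq_same]
      exact hg' _ fun ht => h (by rw [ht])
    · rw [Pi.mulSingle_eq_of_ne hc]
      exact one_mem _

theorem isIrredundant_range_baseComap (hρ : IsModuleTriple ρ) :
    IsIrredundant (Set.range (baseComap ρ : ι × (Fin 3 ⊕ Fin 2) → _)) := by
  constructor
  · rintro _ ⟨⟨c, t⟩, rfl⟩
    exact isCoatom_comap_eval (isCoatom_baseSubgroup hρ t) c
  · intro T hT h
    obtain ⟨_, ⟨p, rfl⟩, hp⟩ := Set.exists_of_ssubset hT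
    obtain ⟨g, hg, hg'⟩ := exists_witness_comap hρ p
    apply hg
    have : g ∈ sInf T := by
      refine Subgroup.mem_sInf.2 fun K hK => ?_
      obtain ⟨q, rfl⟩ := hT.1 hK
      exact hg' q fun hq => hp (hq ▸ hK)
    rw [h] at this
    exact Subgroup.mem_sInf.1 this _ ⟨p, rfl⟩

theorem eq_inr_right_of_mem {g : SemiProd ρ} (h : ∀ i, g ∈ baseSubgroup ρ (.inl i)) :
    g = SemidirectProduct.inr g.right :=
  ext_semiProd (fun i => mem_baseSubgroup_inl.1 (h i)) rfl

/-- If $gu\in K$ with $g$ having zero $(c,i)$-coordinate, the commutator of $z$ with $gu$ is the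
translate $g\cdot u$ in the module; it lies in $K$, so $u=0$. -/
theorem baseComap_le (hρ : IsModuleTriple ρ) {K : Subgroup (ι → SemiProd ρ)} (hK : IsCoatom K)
    {c : ι} {i : Fin 3} (h : Misses K c i) (hz : embX ρ c (centralInvolution i) ∈ K) :
    baseComap ρ (c, .inl i) ≤ K := by
  intro g hg
  rw [mem_baseComap, mem_baseSubgroup_inl] at hg
  obtain ⟨u, hu⟩ := exists_mul_emb_mem hK h g
  have h1 := embX_centralInvolution_mul hρ c i (g * emb ρ c i u)
  have h2 : ((g * emb ρ c i u) c).left.toAdd i = ρ i (g c).right u := by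
    rw [Pi.mul_apply, mul_left_apply, hg, zero_add]
    simp [emb, incl_left_apply]
  have h3 : emb ρ c i (ρ i (g c).right u) ∈ K := by
    have h4 := mul_mem (mul_mem (mul_mem hz hu) (inv_mem hz)) (inv_mem hu)
    rwa [h1, h2, mul_inv_cancel_right, mul_inv_cancel_right] at h4
  have h5 := eq_zero_of_emb_mem hρ hK h h3
  have h6 : u = 0 := by
    have := congrArg (ρ i (g c).right⁻¹) h5
    simpa using this
  rwa [h6, emb_zero, mul_one] at hu

/-- As $x$ commutes with $z$, a commutator of $x$ and $zu$ is $xu-u$, an element of $K$ in the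
missed module. -/
theorem rho_eq_self_of_embX_mem (hρ : IsModuleTriple ρ) {K : Subgroup (ι → SemiProd ρ)}
    (hK : IsCoatom K) {c : ι} {i : Fin 3} (h : Misses K c i) {u : A i}
    (hz : embX ρ c (centralInvolution i) * emb ρ c i u ∈ K) {x : X} (hx : embX ρ c x ∈ K) :
    ρ i x u = u := by
  have h1 := mul_mem (inv_mem hz) (mul_mem (mul_mem hx hz) (inv_mem hx))
  have h2 : embX ρ c x * embX ρ c (centralInvolution i) =
      embX ρ c (centralInvolution i) * embX ρ c x := by
    rw [← map_mul, ← map_mul, centralInvolution_comm]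
  have h3 : (embX ρ c x c).right = x := by simp [embX_apply]
  rw [← mul_assoc (embX ρ c x), h2, mul_assoc (embX ρ c _) (embX ρ c x),
    mul_emb c i u (embX ρ c x), h3,
    mul_inv_rev, ← mul_assoc (embX ρ c _) (emb ρ c i _), mul_inv_cancel_right,
    mul_assoc, inv_mul_cancel_left, ← emb_neg, ← emb_add] at h1
  exact (neg_add_eq_zero.1 (eq_zero_of_emb_mem hρ hK h h1)).symm

theorem isMaximalIrredundant_range_baseComap [Finite ι] (hρ : IsModuleTriple ρ) :
    IsMaximalIrredundant (Set.range (baseComap ρ : ι × (Fin 3 ⊕ Fin 2) → _)) := by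
  refine ⟨isIrredundant_range_baseComap hρ, fun S hS hle => ?_⟩
  intro K hKS
  by_contra hKM
  have hK := hS.1 K hKS
  have hcp : ∀ p, IsCoatom (baseComap ρ p) := fun p => hS.1 _ (hle ⟨p, rfl⟩)
  have hne : ∀ p, baseComap ρ p ≠ K := fun p h => hKM ⟨p, h⟩
  by_cases hm : ∃ c i, Misses K c i
  · obtain ⟨c, i, hm⟩ := hm
    obtain ⟨u, hu⟩ := exists_mul_emb_mem hK hm (embX ρ c (centralInvolution i))
    by_cases hu0 : u = 0
    · rw [hu0, emb_zero, mul_one] at hu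
      exact hne _ ((hcp _).le_iff_eq hK.1 |>.1 (baseComap_le hρ hK hm hu)).symm
    -- Irredundance at the $j$-th parity kernel of factor $c$ gives an element of $K$ lying in all
    -- the other chosen subgroups. Its components lie in the copies of $X$; those outside $c$ have
    -- trivial parities and so lie in $K$, hence so does the component at $c$.
    · have key : ∀ j : Fin 2, ∃ x : X, ρ i x u = u ∧ ∀ l, parity l x = 1 ↔ l ≠ j := by
        intro j
        obtain ⟨g, hg, hgj⟩ := hS.exists_mem_notMem (hle ⟨(c, .inr j), rfl⟩)
        have hgK : g ∈ K := hg K hKS (hne _).symm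
        have hmem : ∀ q : ι × (Fin 3 ⊕ Fin 2), q ≠ (c, .inr j) → g ∈ baseComap ρ q := by
          intro q hq
          refine hg _ (hle ⟨q, rfl⟩) fun h => ?_
          -- The witness shows that different indices give different subgroups.
          obtain ⟨w, hw, hw'⟩ := exists_witness_comap hρ q
          exact hw (h ▸ hw' _ hq.symm)
        have hinr : ∀ d, g d = SemidirectProduct.inr (g d).right := fun d =>
          eq_inr_right_of_mem fun i => mem_baseComap.1 (hmem (d, .inl i) (by simp))
        have hother : ∀ d, d ≠ c → embX ρ d (g d).right ∈ K := fun d hd =>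
          map_mem_of_parity _ K (fun i' => embX_mem_of_not_misses hρ hK fun hm' =>
            hd (misses_unique hρ hK hm' hm).1) fun l =>
              mem_baseSubgroup_inr.1 (mem_baseComap.1 (hmem (d, .inr l) (by simp [hd])))
        have hc : embX ρ c (g c).right ∈ K := by
          have h1 : g * (embX ρ c (g c).right)⁻¹ ∈ K := by
            refine Subgroup.pi_mem_of_mulSingle_mem _ fun d => ?_
            by_cases hd : d = c
            · subst hd
              have : (g * (embX ρ d (g d).right)⁻¹) d = 1 := by
                rw [Pi.mul_apply, Pi.inv_apply, embX_apply, Pi.mulSingle_eq_same, ← hinr,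
                  mul_inv_cancel]
              rw [this, Pi.mulSingle_one]
              exact one_mem K
            · have : (g * (embX ρ c (g c).right)⁻¹) d = g d := by
                rw [Pi.mul_apply, Pi.inv_apply, embX_apply, Pi.mulSingle_eq_of_ne hd, inv_one,
                  mul_one]
              rw [this, hinr]
              exact hother d hd
          have := mul_mem (inv_mem h1) hgK
          simpa using this
        refine ⟨(g c).right, rho_eq_self_of_embX_mem hρ hK hm hu hc, fun l => ⟨?_, fun hl => ?_⟩⟩
        · rintro h rfl
          exact hgj h
        · exact hmem (c, .inr l) (by simp [hl])
      choose x hx hx' using key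
      exact parity_stabilizer hρ i hu0 hx fun j l => hx' j l
  · push Not at hm
    obtain ⟨g, hg, hgK⟩ := hS.exists_mem_notMem hKS
    apply hgK
    have hmem : ∀ q, g ∈ baseComap ρ q := fun q => hg _ (hle ⟨q, rfl⟩) (hne q)
    refine Subgroup.pi_mem_of_mulSingle_mem _ fun d => ?_
    rw [eq_inr_right_of_mem fun i => mem_baseComap.1 (hmem (d, .inl i))]
    exact map_mem_of_parity (embX ρ d) K
      (fun i => embX_mem_of_not_misses hρ hK (hm d i)) fun l => hmem (d, .inr l)

theorem Mindim_le [Fintype ι] (hρ : IsModuleTriple ρ) :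
    Mindim (ι → SemiProd ρ) ≤ 5 * Fintype.card ι := by
  have h : Mindim (ι → SemiProd ρ) ≤
      (Set.range (baseComap ρ : ι × (Fin 3 ⊕ Fin 2) → _)).ncard :=
    Nat.sInf_le ⟨_, isMaximalIrredundant_range_baseComap hρ, rfl⟩
  refine h.trans ?_
  rw [← Set.image_univ]
  refine (Set.ncard_image_le).trans ?_
  rw [Set.ncard_univ, Nat.card_eq_fintype_card]
  simp [mul_comm]

end Mindim

/-! ### Solubility -/

theorem isSolvable_X : Group.IsSolvable X := by
  have : IsPGroup 2 X := IsPGroup.of_card (n := 5) card_X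
  have : Fact (Nat.Prime 2) := ⟨Nat.prime_two⟩
  have : Group.IsNilpotent X := IsPGroup.isNilpotent ‹_›
  infer_instance

theorem isSolvable_semiProd {A : Fin 3 → Type*} [∀ i, AddCommGroup (A i)]
    [∀ i, Module (ZMod 3) (A i)] (ρ : ∀ i, Representation (ZMod 3) X (A i)) :
    Group.IsSolvable (SemiProd ρ) := by
  have := isSolvable_X
  exact Group.isSolvable_of_ker_le_range (SemidirectProduct.inl (φ := action ρ))
    (SemidirectProduct.rightHom (φ := action ρ)) SemidirectProduct.range_inl_eq_ker_rightHom.ge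

theorem isSolvable_pi_fin {G : Type*} [Group G] [Group.IsSolvable G] (k : ℕ) :
    Group.IsSolvable (Fin k → G) := by
  induction k with
  | zero => infer_instance
  | succ k ih =>
    refine Group.isSolvable_of_isSolvable_injective
      (f := (Pi.evalMonoidHom (fun _ : Fin (k + 1) => G) 0).prod
        (MonoidHom.pi fun j : Fin k => Pi.evalMonoidHom (fun _ : Fin (k + 1) => G) j.succ))
      fun g h hgh => ?_
    rw [Prod.ext_iff] at hgh
    exact funext (Fin.cases hgh.1 fun j => congrFun hgh.2 j)

theorem bounds_pow {A : Fin 3 → Type*} [∀ i, AddCommGroup (A i)]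
    [∀ i, Module (ZMod 3) (A i)] {ρ : ∀ i, Representation (ZMod 3) X (A i)}
    (hρ : IsModuleTriple ρ) (k : ℕ) :
    6 * k ≤ alpha (Fin k → SemiProd ρ) ∧ Mindim (Fin k → SemiProd ρ) ≤ 5 * k := by
  have h1 := le_alpha (ι := Fin k) hρ
  have h2 := Mindim_le (ι := Fin k) hρ
  rw [Fintype.card_fin] at h1 h2
  exact ⟨h1, h2⟩

theorem bounds_semiProd {A : Fin 3 → Type*} [∀ i, AddCommGroup (A i)]
    [∀ i, Module (ZMod 3) (A i)] {ρ : ∀ i, Representation (ZMod 3) X (A i)}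
    (hρ : IsModuleTriple ρ) : 6 ≤ alpha (SemiProd ρ) ∧ Mindim (SemiProd ρ) ≤ 5 := by
  have := finite_semiProd hρ
  have e : SemiProd ρ ≃* (Fin 1 → SemiProd ρ) := (MulEquiv.funUnique (Fin 1) (SemiProd ρ)).symm
  obtain ⟨h1, h2⟩ := bounds_pow hρ 1
  exact ⟨h1.trans (alpha_le_of_mulEquiv e), (Mindim_le_of_mulEquiv e.symm).trans h2⟩

end SolubleExample

end

theorem mainTheorem12 :
    -- the group `X`: order, description as a quotient of the free group, normal subgroups
    (Nat.card SolubleExample.X = 32 ∧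
      Subgroup.closure {SolubleExample.x₁, SolubleExample.x₂} = ⊤ ∧
      Nonempty (FreeGroup (Fin 2) ⧸ SolubleExample.freeKernel ≃* SolubleExample.X) ∧
      ∀ i, ∃ _ : (SolubleExample.N i).Normal,
        Nonempty (SolubleExample.X ⧸ SolubleExample.N i ≃* SolubleExample.D8)) ∧
    -- modules as required exist
    (∃ ρ : ∀ _ : Fin 3, Representation (ZMod 3) SolubleExample.X (Fin 2 → ZMod 3),
      SolubleExample.IsModuleTriple ρ) ∧
    -- the bounds for `G` and for its direct powers, for every choice of the modules
    (∀ (A : Fin 3 → Type*) [∀ i, AddCommGroup (A i)] [∀ i, Module (ZMod 3) (A i)]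
      (ρ : ∀ i, Representation (ZMod 3) SolubleExample.X (A i)),
      SolubleExample.IsModuleTriple ρ →
        Finite (SolubleExample.SemiProd ρ) ∧
        Group.IsSolvable (SolubleExample.SemiProd ρ) ∧
        6 ≤ SolubleExample.alpha (SolubleExample.SemiProd ρ) ∧
        SolubleExample.Mindim (SolubleExample.SemiProd ρ) ≤ 5 ∧
        ∀ k : ℕ, 1 ≤ k →
          Group.IsSolvable (Fin k → SolubleExample.SemiProd ρ) ∧
          6 * k ≤ SolubleExample.alpha (Fin k → SolubleExample.SemiProd ρ) ∧
          SolubleExample.Mindim (Fin k → SolubleExample.SemiProd ρ) ≤ 5 * k ∧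
          (k : ℤ) ≤ (SolubleExample.alpha (Fin k → SolubleExample.SemiProd ρ) : ℤ) -
            (SolubleExample.Mindim (Fin k → SolubleExample.SemiProd ρ) : ℤ)) ∧
    -- the difference is unbounded on finite soluble groups
    (∀ n : ℕ, ∃ (H : Type) (_ : Group H), Finite H ∧ Group.IsSolvable H ∧
      (n : ℤ) ≤ (SolubleExample.alpha H : ℤ) - (SolubleExample.Mindim H : ℤ)) := by
  open SolubleExample in
  refine ⟨⟨card_X, closure_generators, nonempty_quotient_freeKernel, nonempty_quotient_N⟩,
    ⟨moduleTriple, isModuleTriple_moduleTriple⟩, ?_, ?_⟩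
  · intro A _ _ ρ hρ
    have := isSolvable_semiProd ρ
    refine ⟨finite_semiProd hρ, this, (bounds_semiProd hρ).1, (bounds_semiProd hρ).2,
      fun k _ => ?_⟩
    obtain ⟨h1, h2⟩ := bounds_pow hρ k
    exact ⟨isSolvable_pi_fin k, h1, h2, by omega⟩
  · intro n
    have := isSolvable_semiProd moduleTriple
    have := finite_semiProd isModuleTriple_moduleTriple
    obtain ⟨h1, h2⟩ := bounds_pow isModuleTriple_moduleTriple n
    exact ⟨Fin n → SemiProd moduleTriple, inferInstance, inferInstance, isSolvable_pi_fin n,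
      by omega⟩
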